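/- A graph here is a finite multigraph without loops: parallel edges are allowed, and every edge joins two distinct vertices. Let $G$ be such a graph, $s \neq t$ two vertices of $G$ (the terminals), and $p \in [0,1]$. If each edge of $G$ is operational independently with probability $p$, the split reliability $\mathrm{SplitRel}_{s,t}(G,p)$ is the probability that every vertex of $G$ is joined by a path of operational edges to exactly one of $s$ and $t$; that is, $$\mathrm{SplitRel}_{s,t}(G,p)=\sum_{F} p^{|F|}(1-p)^{|E(G)\setminus F|},$$ where the sum is over all $F \subseteq E(G)$ such that the spanning subgraph $(V(G),F)$ has exactly two connected components, one containing $s$ and the other containing $t$. A connected graph $G$ with $n$ vertices and $m$ edges, together with distinct terminals $s,t$, is called an optimal $(n,m)$-graph if for every connected graph $H$ with $n$ vertices and $m$ edges, all distinct vertices $s',t'$ of $H$, and all $p \in (0,1)$, $$\mathrm{SplitRel}_{s,t}(G,p) \ge \mathrm{SplitRel}_{s',t'}(H,p)$$ (by continuity in $p$, it is equivalent to require this for all $p \in [0,1]$). **Theorem.** Let $n \ge 2$ and $m \ge n-1$ be integers. An optimal $(n,m)$-graph exists if and only if $n \le 3$, or $m = n-1$, or $n = m = 4$. -/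

import Mathlib

open scoped Graph

namespace Graph

/-- `x` and `y` can communicate in `G`: they are joined by a (possibly trivial) walk. -/
def Communicates {α β : Type*} (G : Graph α β) (x y : α) : Prop :=
  Relation.ReflTransGen G.Adj x y

/-- A multigraph is connected if it has a vertex and any two of its vertices communicate. -/
def IsConnected {α β : Type*} (G : Graph α β) : Prop :=
  V(G).Nonempty ∧ ∀ x ∈ V(G), ∀ y ∈ V(G), G.Communicates x y

/-- Every vertex of `G` communicates with exactly one of `s` and `t`. -/
def IsSplit {α β : Type*} (G : Graph α β) (s t : α) : Prop :=
  ∀ v ∈ V(G), Xor (G.Communicates v s) (G.Communicates v t)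

/-- The operational states for split reliability: the sets `F` of edges of `G` such that in the
spanning subgraph with edge set `F` every vertex communicates with exactly one of `s` and `t`. -/
def splitStates {α β : Type*} (G : Graph α β) (s t : α) : Set (Set β) :=
  {F | F ⊆ E(G) ∧ (G.restrict F).IsSplit s t}

/-- The split reliability of a finite multigraph `G` with terminals `s` and `t`: the probability
that the set of operational edges is an operational state, when each edge is operational
independently with probability `p`. -/
noncomputable def splitReliability {α β : Type*} (G : Graph α β) (s t : α) (p : ℝ) : ℝ :=
  ∑ᶠ F ∈ G.splitStates s t, p ^ F.ncard * (1 - p) ^ (E(G) \ F).ncard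

/-- `G` is a connected loopless multigraph with exactly `n` vertices and `m` edges, and `s`, `t`
are two distinct vertices of it. (`Set.encard` is used so that infinite sets are excluded.) -/
structure IsTerminalGraph {α β : Type*} (n m : ℕ) (G : Graph α β) (s t : α) : Prop where
  loopless : G.Loopless
  order : V(G).encard = n
  size : E(G).encard = m
  connected : G.IsConnected
  left_mem : s ∈ V(G)
  right_mem : t ∈ V(G)
  ne : s ≠ t

/-- `G` with terminals `s`, `t` is an optimal `(n, m)`-graph for split reliability. -/
def IsOptimal {α β : Type} (n m : ℕ) (G : Graph α β) (s t : α) : Prop :=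
  IsTerminalGraph n m G s t ∧
    ∀ (α' β' : Type) (H : Graph α' β') (s' t' : α'), IsTerminalGraph n m H s' t' →
      ∀ p ∈ Set.Ioo (0 : ℝ) 1, H.splitReliability s' t' p ≤ G.splitReliability s t p

end Graph

/-! Grouping operational states by size gives SplitRel = ∑ N_i p^i (1-p)^(m-i), where N_i
(`splitCount`) counts split states with i edges. A split state has at least n-2 edges and, G being
connected, at most m-1. An optimal graph must therefore maximise both extreme coefficients: N_{n-2}
as p → 0 and N_{m-1} as p → 1 (`splitCount_le_of_lowest`, `splitCount_le_of_highest`).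

For nonexistence these two demands conflict. Write n = d+2 and m = d+k. A path whose last edge is
replaced by k parallel edges (`chain`) has N_{m-1} ≥ d, so an optimal graph has at least d edges
whose single removal leaves a split state (`splitBridges`). Every split state contains all but at
most one of these, whence N_d ≤ dk+1 (`splitCount_le_of_le_splitBridges`). A path ending in a
triangle with one multiple edge (`triangleChain`) has, for d = c+1 and k = l+1, N_d ≥ c(2l+1)+(l+1),
which exceeds dk+1 = cl+c+l+2 exactly when cl > 1.

In the remaining cases the chain maximises every N_i at once, which suffices for optimality
(`isOptimal_chain`). The upper bounds are separate arguments for n = 2, n = 3, trees, and n = m = 4.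
-/

namespace Graph

/-! ### Communication, cuts, and rank criteria for splitness and connectedness -/

section Basic

variable {α β : Type*} {G : Graph α β} {F F' : Set β} {s t u v w x y : α} {e : β}

lemma Communicates.symm (h : G.Communicates x y) : G.Communicates y x := by
  induction h with
  | refl => exact .refl
  | tail _ h ih => exact .head h.symm ih

lemma Communicates.trans (h : G.Communicates x y) (h' : G.Communicates y w) :
    G.Communicates x w :=
  Relation.ReflTransGen.trans h h'

lemma Communicates.restrict_mono (h : (G.restrict F).Communicates x y) (hF : F ⊆ F') :
    (G.restrict F').Communicates x y :=
  Relation.ReflTransGen.mono (fun _ _ ⟨e, he, hl⟩ ↦ ⟨e, hF he, hl⟩) _ _ h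

lemma IsLink.communicates (h : G.IsLink e x y) : G.Communicates x y :=
  .single ⟨e, h⟩

lemma IsLink.communicates_restrict (h : G.IsLink e x y) (he : e ∈ F) :
    (G.restrict F).Communicates x y :=
  .single ⟨e, he, h⟩

lemma Communicates.mem_of_closed {S : Set α} (h : G.Communicates x y)
    (hS : ∀ e u v, G.IsLink e u v → u ∈ S → v ∈ S) (hx : x ∈ S) : y ∈ S := by
  induction h with
  | refl => exact hx
  | tail _ h ih => exact hS _ _ _ h.choose_spec ih

lemma IsConnected.exists_isLink (hG : G.IsConnected) {S : Set α} (hs : s ∈ V(G)) (ht : t ∈ V(G))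
    (hsS : s ∈ S) (htS : t ∉ S) : ∃ e u v, G.IsLink e u v ∧ u ∈ S ∧ v ∉ S := by
  by_contra! h
  exact htS ((hG.2 s hs t ht).mem_of_closed h hsS)

lemma IsSplit.not_communicates (h : G.IsSplit s t) (hs : s ∈ V(G)) : ¬ G.Communicates s t := by
  rcases h s hs with h | h
  · exact h.2
  · exact absurd .refl h.2

/-- A graph is split as soon as no edge leaves a set separating `s` from `t`, and every vertex
other than `s` and `t` has a neighbour of smaller rank. -/
lemma isSplit_of_rank (S : Set α) (r : α → ℕ) (hs : s ∈ S) (ht : t ∉ S)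
    (hS : ∀ e u v, G.IsLink e u v → u ∈ S → v ∈ S)
    (hr : ∀ v ∈ V(G), v = s ∨ v = t ∨ ∃ e w, G.IsLink e v w ∧ r w < r v) : G.IsSplit s t := by
  have key : ∀ k, ∀ v ∈ V(G), r v = k → G.Communicates v s ∨ G.Communicates v t := by
    intro k
    induction k using Nat.strong_induction_on with
    | _ k ih =>
      rintro v hv rfl
      obtain rfl | rfl | ⟨e, w, h, hw⟩ := hr v hv
      · exact .inl .refl
      · exact .inr .refl
      · exact (ih _ hw w h.right_mem rfl).imp (.trans h.communicates) (.trans h.communicates)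
  intro v hv
  have hst : ¬ (G.Communicates v s ∧ G.Communicates v t) := fun h ↦
    ht ((h.1.symm.trans h.2).mem_of_closed hS hs)
  rcases key _ v hv rfl with h | h
  · exact .inl ⟨h, fun h' ↦ hst ⟨h, h'⟩⟩
  · exact .inr ⟨h, fun h' ↦ hst ⟨h', h⟩⟩

lemma isConnected_of_rank (r : α → ℕ) (hs : s ∈ V(G))
    (hr : ∀ v ∈ V(G), v = s ∨ ∃ e w, G.IsLink e v w ∧ r w < r v) : G.IsConnected := by
  have key : ∀ k, ∀ v ∈ V(G), r v = k → G.Communicates v s := by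
    intro k
    induction k using Nat.strong_induction_on with
    | _ k ih =>
      rintro v hv rfl
      obtain rfl | ⟨e, w, h, hw⟩ := hr v hv
      · exact .refl
      · exact .trans h.communicates (ih _ hw w h.right_mem rfl)
  exact ⟨⟨s, hs⟩, fun x hx y hy ↦ (key _ x hx rfl).trans (key _ y hy rfl).symm⟩

/-- If every vertex communicates with a vertex of `W` along edges of `F`, then `G` has at most
`|W| + |F|` vertices. -/
lemma encard_vertexSet_le_add (hF : F.Finite) (hFE : F ⊆ E(G)) (W : Set α)
    (h : ∀ v ∈ V(G), ∃ w ∈ W, (G.restrict F).Communicates v w) :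
    V(G).encard ≤ W.encard + F.encard := by
  induction F, hF using Set.Finite.induction_on generalizing W with
  | empty =>
    refine le_add_right (Set.encard_le_encard fun v hv ↦ ?_)
    obtain ⟨w, hw, hvw⟩ := h v hv
    exact hvw.symm.mem_of_closed (by simp) hw
  | @insert e F he _ ih =>
    -- Deleting the edge `e` costs at most one extra root `z`, namely an endpoint of `e`.
    suffices H : ∃ z, ∀ v ∈ V(G), ∃ w ∈ insert z W, (G.restrict F).Communicates v w by
      obtain ⟨z, hz⟩ := H
      rw [Set.encard_insert_of_notMem he, add_comm F.encard, ← add_assoc]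
      exact (ih ((Set.subset_insert e F).trans hFE) _ hz).trans (by gcongr; exact Set.encard_insert_le W z)
    set R : Set α → Set α := fun W ↦ {v | ∃ w ∈ W, (G.restrict F).Communicates v w} with hR
    have hWR : ∀ {W}, W ⊆ R W := fun {W} v hv ↦ ⟨v, hv, .refl⟩
    have step : ∀ {W f u v}, f ∈ F → G.IsLink f u v → u ∈ R W → v ∈ R W :=
      fun hf hl ⟨w, hw, hc⟩ ↦ ⟨w, hw, .trans (hl.symm.communicates_restrict hf) hc⟩
    have mono : ∀ {z}, R W ⊆ R (insert z W) := fun {z} v ⟨w, hw, hc⟩ ↦ ⟨w, .inr hw, hc⟩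
    obtain ⟨x, y, hxy⟩ := G.exists_isLink_of_mem_edgeSet (hFE (.inl rfl))
    -- If neither end of `e` were reached from `W` along `F`, then `e` could not help `x` to reach
    -- `W` either.
    have hor : x ∈ R W ∨ y ∈ R W := by
      by_contra! hn
      obtain ⟨w, hw, hc⟩ := h x hxy.left_mem
      refine hn.1 (hc.symm.mem_of_closed (S := R W) ?_ (hWR hw))
      rintro f u v ⟨rfl | hf, hl⟩ hu
      · rcases hl.left_eq_or_eq hxy with rfl | rfl
        · exact absurd hu hn.1
        · exact absurd hu hn.2
      · exact step hf hl hu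
    have hboth : ∃ z, x ∈ R (insert z W) ∧ y ∈ R (insert z W) := by
      rcases hor with h | h
      · exact ⟨y, mono h, hWR (.inl rfl)⟩
      · exact ⟨x, hWR (.inl rfl), mono h⟩
    obtain ⟨z, hx, hy⟩ := hboth
    refine ⟨z, fun v hv ↦ ?_⟩
    obtain ⟨w, hw, hc⟩ := h v hv
    refine hc.symm.mem_of_closed (S := R (insert z W)) ?_ (hWR (.inr hw))
    rintro f u v ⟨rfl | hf, hl⟩ hu
    · rcases hl.right_eq_or_eq hxy with rfl | rfl <;> assumption
    · exact step hf hl hu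

end Basic

/-! ### Counts of split states by size -/

section Count

variable {α β : Type*} {G : Graph α β} {F : Set β} {s t u v w x y : α} {e : β} {n m i : ℕ}

/-- The number of split states with exactly `i` edges. -/
noncomputable def splitCount (G : Graph α β) (s t : α) (i : ℕ) : ℕ :=
  {F | F ∈ G.splitStates s t ∧ F.ncard = i}.ncard

lemma finite_splitStates (hE : E(G).Finite) : (G.splitStates s t).Finite :=
  hE.finite_subsets.subset fun _ h ↦ h.1

lemma splitReliability_eq_sum (hE : E(G).Finite) (p : ℝ) :
    G.splitReliability s t p = ∑ i ∈ Finset.range (E(G).ncard + 1),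
      G.splitCount s t i * (p ^ i * (1 - p) ^ (E(G).ncard - i)) := by
  classical
  have hfin := finite_splitStates (s := s) (t := t) hE
  rw [splitReliability, finsum_mem_eq_finite_toFinset_sum _ hfin,
    ← Finset.sum_fiberwise_of_maps_to (g := Set.ncard) (t := Finset.range (E(G).ncard + 1))]
  · refine Finset.sum_congr rfl fun i _ ↦ ?_
    have hcard : G.splitCount s t i = (hfin.toFinset.filter (·.ncard = i)).card := by
      rw [splitCount, ← Set.ncard_coe_finset]
      congr 1
      ext F
      simp
    rw [hcard, ← nsmul_eq_mul, ← Finset.sum_const]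
    refine Finset.sum_congr rfl fun F hF ↦ ?_
    simp only [Finset.mem_filter, Set.Finite.mem_toFinset] at hF
    rw [Set.ncard_sdiff hF.1.1 (hE.subset hF.1.1), hF.2]
  · intro F hF
    rw [Set.Finite.mem_toFinset] at hF
    exact Finset.mem_range_succ_iff.2 (Set.ncard_le_ncard hF.1 hE)

lemma IsTerminalGraph.finite_edgeSet (h : IsTerminalGraph n m G s t) : E(G).Finite :=
  Set.finite_of_encard_eq_coe h.size

lemma IsTerminalGraph.ncard_edgeSet (h : IsTerminalGraph n m G s t) : E(G).ncard = m := by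
  rw [Set.ncard_def, h.size]; rfl

lemma IsTerminalGraph.splitReliability_eq (h : IsTerminalGraph n m G s t) (p : ℝ) :
    G.splitReliability s t p =
      ∑ i ∈ Finset.range (m + 1), G.splitCount s t i * (p ^ i * (1 - p) ^ (m - i)) := by
  rw [splitReliability_eq_sum h.finite_edgeSet, h.ncard_edgeSet]

/-- The two terminals serve as roots, and each edge can attach at most one further vertex. -/
lemma IsTerminalGraph.le_ncard_of_mem_splitStates (h : IsTerminalGraph n m G s t)
    (hF : F ∈ G.splitStates s t) : n ≤ 2 + F.ncard := by
  have hfin := h.finite_edgeSet.subset hF.1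
  have := encard_vertexSet_le_add hfin hF.1 {s, t} fun v hv ↦ by
    rcases hF.2 v hv with h | h
    · exact ⟨s, .inl rfl, h.1⟩
    · exact ⟨t, .inr rfl, h.1⟩
  rw [h.order, Set.encard_pair h.ne, ← hfin.cast_ncard_eq] at this
  exact_mod_cast this

lemma IsTerminalGraph.edgeSet_notMem_splitStates (h : IsTerminalGraph n m G s t) :
    E(G) ∉ G.splitStates s t := fun hE ↦ by
  refine hE.2.not_communicates h.left_mem ?_
  rw [restrict_self]
  exact h.connected.2 s h.left_mem t h.right_mem

lemma splitCount_eq_zero (h : ∀ F ∈ G.splitStates s t, F.ncard ≠ i) : G.splitCount s t i = 0 := by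
  rw [splitCount]
  convert Set.ncard_empty (Set β)
  exact Set.eq_empty_of_forall_notMem fun F hF ↦ h F hF.1 hF.2

lemma IsTerminalGraph.splitCount_of_lt (h : IsTerminalGraph n m G s t) (hi : 2 + i < n) :
    G.splitCount s t i = 0 :=
  splitCount_eq_zero fun _ hF hc ↦ by have := h.le_ncard_of_mem_splitStates hF; omega

lemma IsTerminalGraph.splitCount_size (h : IsTerminalGraph n m G s t) :
    G.splitCount s t m = 0 :=
  splitCount_eq_zero fun F hF hc ↦ h.edgeSet_notMem_splitStates <| by
    rwa [← Set.eq_of_subset_of_ncard_le hF.1 (by rw [hc, h.ncard_edgeSet]) h.finite_edgeSet]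

/-- A pointwise comparison of split reliabilities follows from a comparison of counts. -/
lemma IsTerminalGraph.splitReliability_le {α' β' : Type*} {H : Graph α' β'} {s' t' : α'}
    (hG : IsTerminalGraph n m G s t) (hH : IsTerminalGraph n m H s' t')
    (h : ∀ i, H.splitCount s' t' i ≤ G.splitCount s t i) {p : ℝ} (hp : p ∈ Set.Ioo (0 : ℝ) 1) :
    H.splitReliability s' t' p ≤ G.splitReliability s t p := by
  rw [hG.splitReliability_eq, hH.splitReliability_eq]
  have h0 : 0 ≤ p := hp.1.le
  have h1 : 0 ≤ 1 - p := sub_nonneg.2 hp.2.le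
  gcongr with i
  exact h i

end Count

/-! ### Extreme coefficients from behaviour near p = 0 and p = 1 -/

section Coefficients

/-- If a combination of `p ^ i * (1 - p) ^ (m - i)` is nonnegative on `(0, 1)`, then so is its
lowest coefficient. -/
lemma coeff_nonneg_of_lowest {m k : ℕ} (hk : k ≤ m) (d : ℕ → ℝ) (hd : ∀ i < k, d i = 0)
    (h : ∀ p ∈ Set.Ioo (0 : ℝ) 1,
      0 ≤ ∑ i ∈ Finset.range (m + 1), d i * (p ^ i * (1 - p) ^ (m - i))) : 0 ≤ d k := by
  -- The quotient of the sum by `p ^ k`: nonnegative on (0, 1), continuous, and equal to `d k` at 0.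
  set f : ℝ → ℝ := fun p ↦ ∑ i ∈ Finset.Ico k (m + 1), d i * (p ^ (i - k) * (1 - p) ^ (m - i))
    with hf
  have hfac : ∀ p, ∑ i ∈ Finset.range (m + 1), d i * (p ^ i * (1 - p) ^ (m - i)) = p ^ k * f p := by
    intro p
    rw [← Finset.sum_range_add_sum_Ico _ (show k ≤ m + 1 by omega), Finset.sum_eq_zero, zero_add,
      hf, Finset.mul_sum]
    · refine Finset.sum_congr rfl fun i hi ↦ ?_
      rw [Finset.mem_Ico] at hi
      conv_lhs => rw [← Nat.add_sub_of_le hi.1, pow_add, Nat.add_sub_of_le hi.1]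
      ring
    · intro i hi
      rw [hd i (Finset.mem_range.1 hi), zero_mul]
  have hpos : ∀ p ∈ Set.Ioo (0 : ℝ) 1, 0 ≤ f p := fun p hp ↦
    nonneg_of_mul_nonneg_right (by rw [← hfac]; exact h p hp) (pow_pos hp.1 k)
  have hcont : Continuous f := by fun_prop
  have h0 : f 0 = d k := by
    rw [hf]
    simp only
    rw [Finset.sum_eq_single_of_mem k (by simp; omega)]
    · simp
    · intro i hi hik
      rw [Finset.mem_Ico] at hi
      rw [zero_pow (by omega)]
      ring
  rw [← h0]
  have hcl : (0 : ℝ) ∈ closure (Set.Ioo (0 : ℝ) 1) := by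
    rw [closure_Ioo (by norm_num)]; simp
  exact closure_minimal (t := f ⁻¹' Set.Ici 0) hpos (isClosed_Ici.preimage hcont) hcl

/-- If a combination of `p ^ i * (1 - p) ^ (m - i)` is nonnegative on `(0, 1)`, then so is its
highest coefficient. -/
lemma coeff_nonneg_of_highest {m k : ℕ} (hk : k ≤ m) (d : ℕ → ℝ) (hd : ∀ i ≤ m, k < i → d i = 0)
    (h : ∀ p ∈ Set.Ioo (0 : ℝ) 1,
      0 ≤ ∑ i ∈ Finset.range (m + 1), d i * (p ^ i * (1 - p) ^ (m - i))) : 0 ≤ d k := by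
  -- The substitution p ↦ 1 - p reverses the order of the coefficients.
  have := coeff_nonneg_of_lowest (m := m) (k := m - k) (by omega) (fun i ↦ d (m - i))
    (fun i hi ↦ hd _ (by omega) (by omega)) fun p hp ↦ ?_
  · simpa only [Nat.sub_sub_self hk] using this
  · have := h (1 - p) ⟨by linarith [hp.2], by linarith [hp.1]⟩
    rw [← Finset.sum_range_reflect] at this
    refine this.trans_eq (Finset.sum_congr rfl fun i hi ↦ ?_)
    have hi : i ≤ m := Finset.mem_range_succ_iff.1 hi
    rw [show m + 1 - 1 - i = m - i by omega, Nat.sub_sub_self hi]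
    ring

variable {α β α' β' : Type*} {G : Graph α β} {s t : α} {H : Graph α' β'} {s' t' : α'} {n m i : ℕ}

/-- With `i + 2` vertices, no split state has fewer than `i` edges, so index `i` is the lowest that
can occur. -/
lemma splitCount_le_of_lowest (hG : IsTerminalGraph (i + 2) m G s t)
    (hH : IsTerminalGraph (i + 2) m H s' t') (hi : i ≤ m)
    (h : ∀ p ∈ Set.Ioo (0 : ℝ) 1, H.splitReliability s' t' p ≤ G.splitReliability s t p) :
    H.splitCount s' t' i ≤ G.splitCount s t i := by
  have := coeff_nonneg_of_lowest hi
    (fun i ↦ (G.splitCount s t i : ℝ) - H.splitCount s' t' i) (fun j hj ↦ by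
      rw [hG.splitCount_of_lt (by omega), hH.splitCount_of_lt (by omega), sub_self]) fun p hp ↦ by
    simp_rw [sub_mul]
    rw [Finset.sum_sub_distrib, ← hG.splitReliability_eq, ← hH.splitReliability_eq]
    exact sub_nonneg.2 (h p hp)
  exact_mod_cast sub_nonneg.1 this

/-- The full edge set of a connected graph is never split, so with `m + 1` edges the top index that
can occur is `m`. -/
lemma splitCount_le_of_highest (hG : IsTerminalGraph n (m + 1) G s t)
    (hH : IsTerminalGraph n (m + 1) H s' t')
    (h : ∀ p ∈ Set.Ioo (0 : ℝ) 1, H.splitReliability s' t' p ≤ G.splitReliability s t p) :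
    H.splitCount s' t' m ≤ G.splitCount s t m := by
  have := coeff_nonneg_of_highest (Nat.le_succ m)
    (fun i ↦ (G.splitCount s t i : ℝ) - H.splitCount s' t' i) (fun j hj hj' ↦ by
      obtain rfl : j = m + 1 := by omega
      rw [hG.splitCount_size, hH.splitCount_size, sub_self]) fun p hp ↦ by
    simp_rw [sub_mul]
    rw [Finset.sum_sub_distrib, ← hG.splitReliability_eq, ← hH.splitReliability_eq]
    exact sub_nonneg.2 (h p hp)
  exact_mod_cast sub_nonneg.1 this

end Coefficients

/-! ### Split bridges and the bounds they impose -/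

section Bridges

variable {α β : Type*} {G : Graph α β} {F B : Set β} {s t : α} {e : β} {n m k : ℕ}

/-- The edges whose removal leaves a split state. -/
def splitBridges (G : Graph α β) (s t : α) : Set β :=
  {e | e ∈ E(G) ∧ E(G) \ {e} ∈ G.splitStates s t}

/-- A state with all edges but one is determined by the edge it misses, which is then a split
bridge. -/
lemma IsTerminalGraph.splitCount_le_ncard_splitBridges (h : IsTerminalGraph n (m + 1) G s t) :
    G.splitCount s t m ≤ (G.splitBridges s t).ncard := by
  have hfin : (G.splitBridges s t).Finite := h.finite_edgeSet.subset fun e he ↦ he.1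
  refine (Set.ncard_le_ncard ?_ (hfin.image fun e ↦ E(G) \ {e})).trans (Set.ncard_image_le hfin)
  rintro F ⟨hF, hc⟩
  have h1 : (E(G) \ F).ncard = 1 := by
    rw [Set.ncard_sdiff hF.1 (h.finite_edgeSet.subset hF.1), hc, h.ncard_edgeSet]; omega
  obtain ⟨e, he⟩ := Set.ncard_eq_one.1 h1
  have heF : E(G) \ {e} = F := by rw [← he, Set.sdiff_sdiff_cancel_left hF.1]
  have hmem : e ∈ E(G) \ F := he ▸ rfl
  exact ⟨e, ⟨hmem.1, heF ▸ hF⟩, heF⟩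

lemma mem_of_mem_splitBridges (hs : s ∈ V(G)) (he : e ∈ G.splitBridges s t) (hF : F ⊆ E(G))
    (hst : (G.restrict F).Communicates s t) : e ∈ F := by
  by_contra heF
  exact he.2.2.not_communicates hs
    (hst.restrict_mono fun f hf ↦ ⟨hF hf, fun hfe ↦ heF (hfe ▸ hf)⟩)

/-- A split state contains all but at most one of the split bridges. -/
lemma IsTerminalGraph.exists_splitBridges_subset_insert (h : IsTerminalGraph n m G s t)
    (hF : F ∈ G.splitStates s t) : ∃ x, G.splitBridges s t ⊆ insert x F := by
  -- Adding to `F` an edge leaving the component of `s` joins `s` to `t`, and a set joining them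
  -- contains every split bridge.
  obtain ⟨e, u, v, hl, hu, hv⟩ := h.connected.exists_isLink
    (S := {v | (G.restrict F).Communicates s v}) h.left_mem h.right_mem .refl
    (hF.2.not_communicates h.left_mem)
  refine ⟨e, fun f hf ↦ mem_of_mem_splitBridges h.left_mem hf
    (Set.insert_subset hl.edge_mem hF.1) ?_⟩
  have hvt : (G.restrict F).Communicates v t := by
    rcases hF.2 v hl.right_mem with h | h
    · exact absurd h.1.symm hv
    · exact h.1
  exact (Communicates.restrict_mono hu (Set.subset_insert _ _)).trans
    ((hl.communicates_restrict (Set.mem_insert _ _)).trans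
      (hvt.restrict_mono (Set.subset_insert _ _)))

/-- With at least `n - 2` split bridges, there are at most `(n - 2) * (m - n + 2) + 1` split
states with `n - 2` edges. -/
lemma IsTerminalGraph.splitCount_le_of_le_splitBridges (h : IsTerminalGraph n (m + k) G s t)
    (hm : m ≤ (G.splitBridges s t).ncard) : G.splitCount s t m ≤ m * k + 1 := by
  obtain ⟨B, hB, hBm⟩ := Set.exists_subset_card_eq hm
  have hBE : B ⊆ E(G) := hB.trans fun e he ↦ he.1
  have hBfin := h.finite_edgeSet.subset hBE
  have hDfin : (E(G) \ B).Finite := h.finite_edgeSet.sdiff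
  have hD : (E(G) \ B).ncard = k := by
    rw [Set.ncard_sdiff hBE hBfin, h.ncard_edgeSet, hBm]; omega
  -- A state of size `m` other than `B` misses exactly one `b ∈ B`, hence is `B \ {b}` plus a single
  -- edge outside `B`. This leaves `m * k` pairs, and `B` itself gives the extra 1.
  set g : β × β → Set β := fun q ↦ insert q.2 (B \ {q.1}) with hg
  have hfin : (B ×ˢ (E(G) \ B)).Finite := hBfin.prod hDfin
  have hsub : {F | F ∈ G.splitStates s t ∧ F.ncard = m} ⊆ insert B (g '' (B ×ˢ (E(G) \ B))) := by
    rintro F ⟨hF, hc⟩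
    have hFfin := h.finite_edgeSet.subset hF.1
    by_cases hBF : B ⊆ F
    · left
      exact (Set.eq_of_subset_of_ncard_le hBF (by omega) hFfin).symm
    · right
      obtain ⟨b, hb, hbF⟩ := Set.not_subset.1 hBF
      obtain ⟨x, hx⟩ := h.exists_splitBridges_subset_insert hF
      have hbx : b = x := (hx (hB hb)).resolve_right hbF
      have hsubF : B \ {b} ⊆ F := fun c hc ↦
        (hx (hB hc.1)).resolve_left fun hcx ↦ hc.2 (hcx.trans hbx.symm)
      have hcard : (B \ {b}).ncard + 1 = m := by
        rw [Set.ncard_sdiff_singleton_add_one hb hBfin, hBm]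
      have h1 : (F \ (B \ {b})).ncard = 1 := by
        rw [Set.ncard_sdiff hsubF hBfin.sdiff]; omega
      obtain ⟨y, hy⟩ := Set.ncard_eq_one.1 h1
      have hyF : y ∈ F \ (B \ {b}) := hy ▸ rfl
      have hyB : y ∉ B := fun hyB ↦ hyF.2 ⟨hyB, fun hyb ↦ hbF (hyb ▸ hyF.1)⟩
      refine ⟨(b, y), ⟨hb, hF.1 hyF.1, hyB⟩, ?_⟩
      rw [hg]
      simp only
      rw [Set.insert_eq, ← hy, Set.sdiff_union_of_subset hsubF]
  calc G.splitCount s t m ≤ (insert B (g '' (B ×ˢ (E(G) \ B)))).ncard :=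
        Set.ncard_le_ncard hsub ((hfin.image g).insert B)
    _ ≤ (g '' (B ×ˢ (E(G) \ B))).ncard + 1 := Set.ncard_insert_le _ _
    _ ≤ (B ×ˢ (E(G) \ B)).ncard + 1 := by gcongr; exact Set.ncard_image_le hfin
    _ = m * k + 1 := by rw [Set.ncard_prod, hBm, hD]

/-- A graph with at least as many edges as vertices has at most `n - 2` split bridges. -/
lemma IsTerminalGraph.ncard_splitBridges_lt (h : IsTerminalGraph (n + 1) m G s t) (hm : n < m) :
    (G.splitBridges s t).ncard < n := by
  classical
  by_contra! hn
  have := h.loopless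
  obtain ⟨B, hB, hBn⟩ := Set.exists_subset_card_eq hn
  have hBE : B ⊆ E(G) := hB.trans fun e he ↦ he.1
  have hBfin := h.finite_edgeSet.subset hBE
  set S : β → Set α := fun e ↦ {v | (G.restrict (E(G) \ {e})).Communicates v s} with hS
  -- `g v` counts the bridges in `B` whose removal leaves `v` on the side of `s`: a discrete height
  -- falling from `n` at `s` to 0 at `t`.
  set g : α → ℕ := fun v ↦ (hBfin.toFinset.filter (v ∈ S ·)).card with hg
  have hBc : hBfin.toFinset.card = n := by rw [← hBn, Set.ncard_eq_toFinset_card B hBfin]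
  have hmemS : ∀ {e f u v}, G.IsLink f u v → f ≠ e → u ∈ S e → v ∈ S e := fun {e} _ _ _ hl hfe hu ↦
    (hl.symm.communicates_restrict (F := E(G) \ {e}) ⟨hl.edge_mem, hfe⟩).trans hu
  have hgs : g s = n := by
    rw [← hBc, hg]
    exact congrArg Finset.card (Finset.filter_true_of_mem fun e _ ↦ .refl)
  have hgt : g t = 0 := by
    rw [hg, Finset.card_eq_zero]
    refine Finset.filter_false_of_mem fun e he ht ↦ ?_
    exact (hB (hBfin.mem_toFinset.1 he)).2.2.not_communicates h.left_mem ht.symm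
  have hstep : ∀ {f u v}, G.IsLink f u v → g u ≤ g v + 1 := by
    intro f u v hl
    calc g u ≤ (insert f (hBfin.toFinset.filter (v ∈ S ·))).card := by
          refine Finset.card_le_card fun e he ↦ ?_
          rw [Finset.mem_filter] at he
          by_cases hfe : f = e
          · simp [hfe]
          · exact Finset.mem_insert_of_mem (Finset.mem_filter.2 ⟨he.1, hmemS hl hfe he.2⟩)
      _ ≤ g v + 1 := Finset.card_insert_le _ _
  -- The height changes by at most 1 along an edge, so by connectedness no value between 0 and `n`
  -- is skipped; with only `n + 1` vertices, `g` is then injective.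
  have hsurj : Set.Iic n ⊆ g '' V(G) := by
    intro c hc
    by_contra hno
    have hno : ∀ v ∈ V(G), g v ≠ c := fun v hv hgv ↦ hno ⟨v, hv, hgv⟩
    obtain ⟨f, u, v, hl, hu, hv⟩ := h.connected.exists_isLink (S := {v | c < g v})
      h.left_mem h.right_mem (by
        have := hno s h.left_mem
        simp only [Set.mem_Iic, Set.mem_ofPred_eq] at *
        omega) (by simp [hgt])
    have := hstep hl
    have := hno v hl.right_mem
    simp only [Set.mem_ofPred_eq] at hu hv
    omega
  have hVfin : V(G).Finite := Set.finite_of_encard_eq_coe h.order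
  have hVc : V(G).ncard = n + 1 := by rw [Set.ncard_def, h.order]; rfl
  have hinj : Set.InjOn g V(G) := by
    refine Set.injOn_of_ncard_image_eq (le_antisymm (Set.ncard_image_le hVfin) ?_) hVfin
    have := Set.ncard_le_ncard hsurj (hVfin.image g)
    rwa [← Finset.coe_Iic, Set.ncard_coe_finset, Nat.card_Iic, ← hVc] at this
  -- An edge outside `B` joins vertices of equal height, so injectivity makes it a loop.
  obtain ⟨f, hf, hfB⟩ := Set.exists_mem_notMem_of_ncard_lt_ncard
    (show B.ncard < E(G).ncard by rw [hBn, h.ncard_edgeSet]; exact hm) hBfin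
  obtain ⟨u, v, hl⟩ := G.exists_isLink_of_mem_edgeSet hf
  refine hl.ne (hinj hl.left_mem hl.right_mem (congrArg Finset.card ?_))
  refine Finset.filter_congr fun e he ↦ ?_
  have hfe : f ≠ e := fun hfe ↦ hfB (hfe ▸ hBfin.mem_toFinset.1 he)
  exact ⟨hmemS hl hfe, hmemS hl.symm hfe⟩

end Bridges

end Graph

/-! ### Binomial counting -/

lemma Set.Finite.ncard_setOf_subset_ncard_eq {β : Type*} {A : Set β} (hA : A.Finite) (i : ℕ) :
    {F | F ⊆ A ∧ F.ncard = i}.ncard = A.ncard.choose i := by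
  classical
  lift A to Finset β using hA
  have : {F : Set β | F ⊆ A ∧ F.ncard = i} =
      (fun X : Finset β ↦ (X : Set β)) '' (A.powersetCard i : Set (Finset β)) := by
    ext F
    constructor
    · rintro ⟨hF, hc⟩
      lift F to Finset β using A.finite_toSet.subset hF
      rw [Set.ncard_coe_finset] at hc
      exact ⟨F, Finset.mem_coe.2 (Finset.mem_powersetCard.2 ⟨Finset.coe_subset.1 hF, hc⟩), rfl⟩
    · rintro ⟨X, hX, rfl⟩
      have hX := Finset.mem_powersetCard.1 (Finset.mem_coe.1 hX)
      exact ⟨Finset.coe_subset.2 hX.1, by rw [Set.ncard_coe_finset, hX.2]⟩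
  rw [this, Set.ncard_image_of_injective _ Finset.coe_injective, Set.ncard_coe_finset,
    Finset.card_powersetCard, Set.ncard_coe_finset]

/-- Convexity: concentrating the edges in one class, with a single edge left over, does not lower
the count. The term `Nat.choose 0 j` is 1 for `j = 0` and 0 otherwise. -/
lemma Nat.choose_add_choose_le_choose_add (a b j : ℕ) :
    (a + 1).choose (j + 1) + (b + 1).choose (j + 1) ≤
      (a + b + 1).choose (j + 1) + Nat.choose 0 j := by
  induction b with
  | zero => simp [Nat.choose_succ_succ]
  | succ b ih =>
    rw [Nat.choose_succ_succ' (b + 1), ← add_assoc a b 1, Nat.choose_succ_succ' (a + b + 1)]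
    have : (b + 1).choose j ≤ (a + b + 1).choose j := Nat.choose_le_choose j (by omega)
    omega

namespace Graph

/-! ### Upper bounds on the counts in the exceptional cases -/

section UpperBounds

variable {α β : Type*} {G : Graph α β} {F : Set β} {s t u v w x y : α} {e : β}
  {n m d k i j : ℕ}

/-- The number of split states with `d + j` edges of the path on `d + 2` vertices whose last edge
is replaced by `k` parallel edges. -/
def chainCount (d k j : ℕ) : ℕ := d * k.choose (j + 1) + Nat.choose 0 j

lemma splitCount_le_choose (hE : E(G).Finite) (i : ℕ) :
    G.splitCount s t i ≤ E(G).ncard.choose i := by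
  rw [← hE.ncard_setOf_subset_ncard_eq]
  exact Set.ncard_le_ncard (fun F hF ↦ ⟨hF.1.1, hF.2⟩)
    (hE.finite_subsets.subset fun F hF ↦ hF.1)

lemma IsTerminalGraph.splitCount_of_size_le (h : IsTerminalGraph n m G s t) (hi : m ≤ i) :
    G.splitCount s t i = 0 := by
  obtain rfl | hi := hi.eq_or_lt
  · exact h.splitCount_size
  · have := splitCount_le_choose (s := s) (t := t) h.finite_edgeSet i
    rwa [h.ncard_edgeSet, Nat.choose_eq_zero_of_lt hi, Nat.le_zero] at this

lemma IsSplit.not_isLink (h : G.IsSplit s t) (hs : s ∈ V(G)) : ¬ G.IsLink e s t :=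
  fun hl ↦ h.not_communicates hs hl.communicates

lemma IsTerminalGraph.encard_sdiff (h : IsTerminalGraph (n + 2) m G s t) :
    (V(G) \ {s, t}).encard = n := by
  have := Set.encard_sdiff_add_encard_of_subset
    (Set.insert_subset h.left_mem (Set.singleton_subset_iff.2 h.right_mem))
  rw [Set.encard_pair h.ne, h.order] at this
  push_cast at this
  exact ENat.add_left_injective_of_ne_top (n := 2) (ENat.ofNat_ne_top 2) this

/-- Every edge joins `s` to `t`, so only the empty set can be split. -/
lemma IsTerminalGraph.splitCount_le_of_order_two (h : IsTerminalGraph 2 m G s t) (j : ℕ) :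
    G.splitCount s t j ≤ chainCount 0 m j := by
  cases j with
  | zero => simpa [chainCount] using splitCount_le_choose (s := s) (t := t) h.finite_edgeSet 0
  | succ j =>
    refine (splitCount_eq_zero fun F hF hc ↦ ?_).le.trans (Nat.zero_le _)
    have := h.loopless
    obtain ⟨e, he⟩ := Set.nonempty_of_ncard_ne_zero (hc.trans_ne (Nat.succ_ne_zero j))
    obtain ⟨x, y, hl⟩ := G.exists_isLink_of_mem_edgeSet (hF.1 he)
    have hV : ∀ v ∈ V(G), v = s ∨ v = t := by
      have := Set.encard_eq_zero.1 (h.encard_sdiff (n := 0))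
      intro v hv
      by_contra hvst
      exact (this ▸ ⟨hv, hvst⟩ : v ∈ (∅ : Set α))
    have hxy := hl.ne
    have hst : G.IsLink e s t := by
      rcases hV x hl.left_mem with rfl | rfl <;> rcases hV y hl.right_mem with rfl | rfl
      exacts [absurd rfl hxy, hl, hl.symm, absurd rfl hxy]
    exact hF.2.not_isLink h.left_mem (e := e) ⟨he, hst⟩

/-- A split state avoids edges between `s` and `t`, and cannot join the third vertex to both. It
therefore lies entirely in one of the two classes of edges at that vertex. -/
lemma IsTerminalGraph.splitCount_le_of_order_three (h : IsTerminalGraph 3 (1 + k) G s t) (j : ℕ) :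
    G.splitCount s t (1 + j) ≤ chainCount 1 k j := by
  have := h.loopless
  obtain ⟨v, hv⟩ := Set.encard_eq_one.1 (h.encard_sdiff (n := 1))
  have hvV : v ∈ V(G) \ {s, t} := hv ▸ rfl
  have hvs : v ≠ s := fun h ↦ hvV.2 (.inl h)
  have hvt : v ≠ t := fun h ↦ hvV.2 (.inr h)
  have hV : ∀ x ∈ V(G), x = s ∨ x = t ∨ x = v := by
    intro x hx
    by_contra! hn
    have : x ∈ V(G) \ {s, t} := ⟨hx, by simp [hn.1, hn.2.1]⟩
    rw [hv] at this
    exact hn.2.2 this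
  set A : Set β := {e | G.IsLink e s v}
  set B : Set β := {e | G.IsLink e t v}
  have hAE : A ⊆ E(G) := fun e he ↦ IsLink.edge_mem he
  have hBE : B ⊆ E(G) := fun e he ↦ IsLink.edge_mem he
  have hAfin := h.finite_edgeSet.subset hAE
  have hBfin := h.finite_edgeSet.subset hBE
  have hcover : ∀ e ∈ E(G), ¬ G.IsLink e s t → e ∈ A ∨ e ∈ B := by
    intro e he hst
    obtain ⟨x, y, hl⟩ := G.exists_isLink_of_mem_edgeSet he
    have hxy := hl.ne
    have hst' : ¬ G.IsLink e t s := fun h ↦ hst h.symm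
    rcases hV x hl.left_mem with rfl | rfl | rfl <;>
      rcases hV y hl.right_mem with rfl | rfl | rfl <;>
      first
        | exact absurd rfl hxy | exact absurd hl hst | exact absurd hl hst'
        | exact .inl hl | exact .inr hl | exact .inl hl.symm | exact .inr hl.symm
  have hsub : {F | F ∈ G.splitStates s t ∧ F.ncard = 1 + j} ⊆
      {F | F ⊆ A ∧ F.ncard = j + 1} ∪ {F | F ⊆ B ∧ F.ncard = j + 1} := by
    rintro F ⟨hF, hc⟩
    rw [add_comm] at hc
    have hcov : ∀ e ∈ F, e ∈ A ∨ e ∈ B := fun e he ↦ hcover e (hF.1 he) fun hst ↦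
      hF.2.not_isLink h.left_mem (e := e) ⟨he, hst⟩
    by_contra hn
    have hA : ¬ F ⊆ A := fun hA ↦ hn (.inl ⟨hA, hc⟩)
    have hB : ¬ F ⊆ B := fun hB ↦ hn (.inr ⟨hB, hc⟩)
    obtain ⟨e, he, heA⟩ := Set.not_subset.1 hA
    obtain ⟨f, hf, hfB⟩ := Set.not_subset.1 hB
    have heB : G.IsLink e t v := (hcov e he).resolve_left heA
    have hfA : G.IsLink f s v := (hcov f hf).resolve_right hfB
    exact hF.2.not_communicates h.left_mem
      ((hfA.communicates_restrict hf).trans (heB.symm.communicates_restrict he))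
  have hle : G.splitCount s t (1 + j) ≤ A.ncard.choose (j + 1) + B.ncard.choose (j + 1) := by
    rw [← hAfin.ncard_setOf_subset_ncard_eq, ← hBfin.ncard_setOf_subset_ncard_eq]
    exact (Set.ncard_le_ncard hsub ((hAfin.finite_subsets.subset fun F hF ↦ hF.1).union
      (hBfin.finite_subsets.subset fun F hF ↦ hF.1))).trans (Set.ncard_union_le _ _)
  have hdisj : Disjoint A B := Set.disjoint_left.2 fun e (heA : G.IsLink e s v) heB ↦
    h.ne (heA.left_unique heB)
  have hAB : A.ncard + B.ncard ≤ 1 + k := by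
    rw [← Set.ncard_union_eq hdisj hAfin hBfin, ← h.ncard_edgeSet]
    exact Set.ncard_le_ncard (Set.union_subset hAE hBE) h.finite_edgeSet
  -- Some edge meets `t` and so lies outside `A`; this settles the case where `B` is empty.
  have hAk : A.ncard < 1 + k := by
    obtain ⟨e, u, w, hl, rfl, -⟩ := h.connected.exists_isLink (S := {t}) h.right_mem h.left_mem
      rfl h.ne
    rw [← h.ncard_edgeSet]
    refine Set.ncard_lt_ncard ⟨hAE, fun hEA ↦ ?_⟩ h.finite_edgeSet
    rcases hl.left_eq_or_eq (hEA hl.edge_mem : G.IsLink e s v) with h' | h'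
    exacts [h.ne h'.symm, hvt h'.symm]
  have hBk : B.ncard < 1 + k := by
    obtain ⟨e, u, w, hl, rfl, -⟩ := h.connected.exists_isLink (S := {s}) h.left_mem h.right_mem
      rfl h.ne.symm
    rw [← h.ncard_edgeSet]
    refine Set.ncard_lt_ncard ⟨hBE, fun hEB ↦ ?_⟩ h.finite_edgeSet
    rcases hl.left_eq_or_eq (hEB hl.edge_mem : G.IsLink e t v) with h' | h'
    exacts [h.ne h', hvs h'.symm]
  refine hle.trans ?_
  rw [chainCount, one_mul]
  generalize A.ncard = a at *
  generalize B.ncard = b at *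
  cases a with
  | zero =>
    have := Nat.choose_le_choose (j + 1) (show b ≤ k by omega)
    simp only [Nat.choose_zero_succ]
    omega
  | succ a =>
    cases b with
    | zero =>
      have := Nat.choose_le_choose (j + 1) (show a + 1 ≤ k by omega)
      simp only [Nat.choose_zero_succ]
      omega
    | succ b =>
      have := Nat.choose_le_choose (j + 1) (show a + b + 1 ≤ k by omega)
      have := Nat.choose_add_choose_le_choose_add a b j
      omega

/-- At size `d` the bound is the trivial one, the number `d + 1` of `d`-subsets of the edges; larger
sizes contribute nothing. -/
lemma IsTerminalGraph.splitCount_le_of_tree (h : IsTerminalGraph n (d + 1) G s t) (j : ℕ) :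
    G.splitCount s t (d + j) ≤ chainCount d 1 j := by
  cases j with
  | zero =>
    have := splitCount_le_choose (s := s) (t := t) h.finite_edgeSet d
    rw [h.ncard_edgeSet, Nat.choose_succ_self_right] at this
    simpa [chainCount] using this
  | succ j => exact (h.splitCount_of_size_le (by omega)).le.trans (Nat.zero_le _)

/-- In a graph with four vertices and four edges, some two edges do not form a split state. -/
lemma IsTerminalGraph.exists_pair_notMem_splitStates (h : IsTerminalGraph 4 4 G s t) :
    ∃ e ∈ E(G), ∃ f ∈ E(G), e ≠ f ∧ {e, f} ∉ G.splitStates s t := by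
  classical
  by_contra! hall
  have := h.loopless
  obtain ⟨a, b, hab, hV⟩ := Set.encard_eq_two.1 (h.encard_sdiff (n := 2))
  have haV : a ∈ V(G) \ {s, t} := hV ▸ .inl rfl
  have hbV : b ∈ V(G) \ {s, t} := hV ▸ .inr rfl
  have hsa : s ≠ a := fun h ↦ haV.2 (.inl h.symm)
  have hta : t ≠ a := fun h ↦ haV.2 (.inr h.symm)
  have hsb : s ≠ b := fun h ↦ hbV.2 (.inl h.symm)
  have htb : t ≠ b := fun h ↦ hbV.2 (.inr h.symm)
  have hVst : ∀ x ∈ V(G), x ≠ a → x ≠ b → x = s ∨ x = t := by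
    intro x hx hxa hxb
    by_contra hn
    have : x ∈ V(G) \ {s, t} := ⟨hx, hn⟩
    rw [hV] at this
    rcases this with h | h
    exacts [hxa h, hxb h]
  have hc : h.finite_edgeSet.toFinset.card = 4 := by
    rw [← Set.ncard_eq_toFinset_card _ h.finite_edgeSet, h.ncard_edgeSet]
  -- Edges are classified by their incidence with the nonterminals `a` and `b`. An edge meeting
  -- neither joins `s` to `t`, which no split pair allows, so four edges fall into three classes.
  -- Two edges in one class either both miss one of `a`, `b`, isolating it, or both join `a` to `b`,
  -- cutting these off from the terminals.
  set φ : β → Bool × Bool := fun e ↦ (decide (G.Inc e a), decide (G.Inc e b)) with hφ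
  have hmaps : ∀ e ∈ h.finite_edgeSet.toFinset, φ e ∈ Finset.univ.erase (false, false) := by
    intro e he
    have heE := h.finite_edgeSet.mem_toFinset.1 he
    refine Finset.mem_erase.2 ⟨fun hφe ↦ ?_, Finset.mem_univ _⟩
    have ha : ¬ G.Inc e a := of_decide_eq_false (congrArg Prod.fst hφe)
    have hb : ¬ G.Inc e b := of_decide_eq_false (congrArg Prod.snd hφe)
    obtain ⟨x, y, hl⟩ := G.exists_isLink_of_mem_edgeSet heE
    have hx := hVst x hl.left_mem (fun h ↦ ha (h ▸ hl.inc_left)) (fun h ↦ hb (h ▸ hl.inc_left))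
    have hy := hVst y hl.right_mem (fun h ↦ ha (h ▸ hl.inc_right)) (fun h ↦ hb (h ▸ hl.inc_right))
    have hxy := hl.ne
    have hst : G.IsLink e s t := by
      rcases hx with rfl | rfl <;> rcases hy with rfl | rfl
      exacts [absurd rfl hxy, hl, hl.symm, absurd rfl hxy]
    obtain ⟨f, hf, hfe⟩ := Finset.exists_mem_ne (by rw [hc]; norm_num) e
    exact (hall e heE f (h.finite_edgeSet.mem_toFinset.1 hf) hfe.symm).2.not_isLink h.left_mem
      (e := e) ⟨.inl rfl, hst⟩
  obtain ⟨e, he, f, hf, hef, hφef⟩ := Finset.exists_ne_map_eq_of_card_lt_of_maps_to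
    (by rw [hc]; decide) hmaps
  have hsplit := (hall e (h.finite_edgeSet.mem_toFinset.1 he) f
    (h.finite_edgeSet.mem_toFinset.1 hf) hef).2
  have hia : G.Inc e a ↔ G.Inc f a := decide_eq_decide.1 (congrArg Prod.fst hφef)
  have hib : G.Inc e b ↔ G.Inc f b := decide_eq_decide.1 (congrArg Prod.snd hφef)
  have hclosed : ∀ (S : Set α) (x : α), x ∈ V(G) → x ∈ S → s ∉ S → t ∉ S →
      ¬ ∀ g u v, (G.restrict {e, f}).IsLink g u v → u ∈ S → v ∈ S := by
    intro S x hxV hx hs ht hS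
    rcases hsplit x hxV with h | h
    exacts [hs (h.1.mem_of_closed hS hx), ht (h.1.mem_of_closed hS hx)]
  have hisol : ∀ x, x ∈ V(G) → s ≠ x → t ≠ x → (G.Inc e x ↔ G.Inc f x) → G.Inc e x := by
    intro x hx hs ht hxx
    by_contra hn
    refine hclosed {x} x hx rfl hs ht ?_
    rintro g u v ⟨rfl | rfl, hl⟩ rfl
    exacts [absurd hl.inc_left hn, absurd hl.inc_left (mt hxx.2 hn)]
  have hea := hisol a haV.1 hsa hta hia
  have heb := hisol b hbV.1 hsb htb hib
  refine hclosed {a, b} a haV.1 (.inl rfl) (by simp [hsa, hsb]) (by simp [hta, htb]) ?_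
  have hends : ∀ g u v, G.Inc g a → G.Inc g b → G.IsLink g u v → v ∈ ({a, b} : Set α) := by
    intro g u v ha hb hl
    rcases ha.eq_or_eq_of_isLink hl with rfl | rfl
    · rcases hb.eq_or_eq_of_isLink hl with rfl | rfl
      exacts [absurd rfl hab, .inr rfl]
    · exact .inl rfl
  rintro g u v ⟨rfl | rfl, hl⟩ -
  exacts [hends _ _ _ hea heb hl, hends _ _ _ (hia.1 hea) (hib.1 heb) hl]

/-- The bounds are 5, one less than the number of pairs of edges, then 2, from the bound on split
bridges, then 0. -/
lemma IsTerminalGraph.splitCount_le_of_order_four (h : IsTerminalGraph 4 4 G s t) (j : ℕ) :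
    G.splitCount s t (2 + j) ≤ chainCount 2 2 j := by
  match j with
  | 0 =>
    obtain ⟨e, he, f, hf, hef, hn⟩ := h.exists_pair_notMem_splitStates
    have hlt : G.splitCount s t 2 < {F | F ⊆ E(G) ∧ F.ncard = 2}.ncard := by
      refine Set.ncard_lt_ncard ⟨fun F hF ↦ ⟨hF.1.1, hF.2⟩, fun hsub ↦ ?_⟩
        (h.finite_edgeSet.finite_subsets.subset fun F hF ↦ hF.1)
      exact hn (hsub ⟨Set.insert_subset he (Set.singleton_subset_iff.2 hf),
        Set.ncard_pair hef⟩).1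
    rw [h.finite_edgeSet.ncard_setOf_subset_ncard_eq, h.ncard_edgeSet] at hlt
    exact Nat.le_of_lt_succ hlt
  | 1 =>
    have h1 := h.splitCount_le_ncard_splitBridges
    have h2 := h.ncard_splitBridges_lt (by norm_num)
    exact Nat.le_of_lt_succ (h1.trans_lt h2)
  | j + 2 => exact (h.splitCount_of_size_le (by omega)).le.trans (Nat.zero_le _)

end UpperBounds

/-! ### Explicit multigraphs and lower bounds from families of states -/

section Constructions

/-- The multigraph with vertices `0, …, n - 1` and edges `0, …, m - 1`, in which the edge `e`
joins `a e` and `b e`. -/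
def ofEnds (n m : ℕ) (a b : ℕ → ℕ) (h : ∀ e < m, a e < n ∧ b e < n) : Graph ℕ ℕ where
  vertexSet := Set.Iio n
  edgeSet := Set.Iio m
  IsLink e x y := e < m ∧ (x = a e ∧ y = b e ∨ x = b e ∧ y = a e)
  isLink_symm e _ := ⟨fun x y hl ↦ ⟨hl.1, hl.2.symm.imp And.symm And.symm⟩⟩
  eq_or_eq_of_isLink_of_isLink := by
    rintro e x y v w ⟨-, ⟨rfl, rfl⟩ | ⟨rfl, rfl⟩⟩ ⟨-, ⟨rfl, rfl⟩ | ⟨rfl, rfl⟩⟩ <;> simp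
  edge_mem_iff_exists_isLink e :=
    ⟨fun he ↦ ⟨a e, b e, he, .inl ⟨rfl, rfl⟩⟩, fun ⟨_, _, he, _⟩ ↦ he⟩
  left_mem_of_isLink := by
    rintro e x y ⟨he, ⟨rfl, rfl⟩ | ⟨rfl, rfl⟩⟩
    exacts [(h e he).1, (h e he).2]

variable {n m : ℕ} {a b : ℕ → ℕ} {h : ∀ e < m, a e < n ∧ b e < n}

lemma ofEnds_isLink {e : ℕ} (he : e < m) : (ofEnds n m a b h).IsLink e (a e) (b e) :=
  ⟨he, .inl ⟨rfl, rfl⟩⟩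

lemma isTerminalGraph_ofEnds {s t : ℕ} (hab : ∀ e < m, a e ≠ b e) (hs : s < n) (ht : t < n)
    (hst : s ≠ t) (hconn : (ofEnds n m a b h).IsConnected) :
    IsTerminalGraph n m (ofEnds n m a b h) s t where
  loopless := by
    refine ⟨fun e x hl ↦ ?_⟩
    obtain ⟨he, ⟨h1, h2⟩ | ⟨h1, h2⟩⟩ := hl
    exacts [hab e he (h1.symm.trans h2), hab e he (h2.symm.trans h1)]
  order := by
    change (Set.Iio n).encard = n
    rw [← Finset.coe_Iio, Set.encard_coe_eq_coe_finsetCard, Nat.card_Iio]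
  size := by
    change (Set.Iio m).encard = m
    rw [← Finset.coe_Iio, Set.encard_coe_eq_coe_finsetCard, Nat.card_Iio]
  connected := hconn
  left_mem := hs
  right_mem := ht
  ne := hst

/-- A lower bound for the number of split states with `i` edges, from a family of states that
contain all but one of the edges `0, …, c - 1` and one of states that contain all of them. -/
lemma le_splitCount_of_families {G : Graph ℕ ℕ} {s t : ℕ} (hE : E(G).Finite) (c i : ℕ)
    (T U : Finset (Finset ℕ)) (hT : ∀ X ∈ T, ∀ x ∈ X, c ≤ x) (hU : ∀ X ∈ U, ∀ x ∈ X, c ≤ x)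
    (hTi : ∀ X ∈ T, X.card + c = i + 1) (hUi : ∀ X ∈ U, X.card + c = i)
    (hTs : ∀ g < c, ∀ X ∈ T, (((Finset.range c).erase g ∪ X : Finset ℕ) : Set ℕ) ∈
      G.splitStates s t)
    (hUs : ∀ X ∈ U, ((Finset.range c ∪ X : Finset ℕ) : Set ℕ) ∈ G.splitStates s t) :
    c * T.card + U.card ≤ G.splitCount s t i := by
  classical
  set f : ℕ × Finset ℕ → Finset ℕ := fun q ↦ (Finset.range c).erase q.1 ∪ q.2 with hf
  set g : Finset ℕ → Finset ℕ := fun X ↦ Finset.range c ∪ X with hg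
  -- A set splits uniquely into its part below `c` and its part from `c` on, so distinct data give
  -- distinct states.
  have low : ∀ {R X R' X' : Finset ℕ}, R ⊆ Finset.range c → R' ⊆ Finset.range c →
      (∀ x ∈ X, c ≤ x) → (∀ x ∈ X', c ≤ x) → R ∪ X = R' ∪ X' → R = R' ∧ X = X' := by
    intro R X R' X' hR hR' hX hX' he
    simp only [Finset.subset_iff, Finset.mem_range] at hR hR'
    simp only [Finset.ext_iff, Finset.mem_union] at he ⊢
    constructor
    · intro x
      have := he x
      have := @hR x; have := @hR' x; have := hX x; have := hX' x
      grind
    · intro x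
      have := he x
      have := @hR x; have := @hR' x; have := hX x; have := hX' x
      grind
  have herase : ∀ g', (Finset.range c).erase g' ⊆ Finset.range c :=
    fun g' ↦ Finset.erase_subset _ _
  have hfinj : Set.InjOn f (Finset.range c ×ˢ T : Finset _) := by
    rintro ⟨x, X⟩ hx ⟨y, Y⟩ hy hxy
    simp only [Finset.coe_product, Set.mem_prod, Finset.mem_coe, Finset.mem_range] at hx hy
    obtain ⟨h1, rfl⟩ := low (herase x) (herase y) (hT X hx.2) (hT Y hy.2) hxy
    have := Finset.erase_injOn (Finset.range c) (Finset.mem_coe.2 (Finset.mem_range.2 hx.1))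
      (Finset.mem_coe.2 (Finset.mem_range.2 hy.1)) h1
    rw [this]
  have hginj : Set.InjOn g U := fun X hX Y hY hXY ↦
    (low subset_rfl subset_rfl (hU X hX) (hU Y hY) hXY).2
  have hdisj : Disjoint ((Finset.range c ×ˢ T).image f) (U.image g) := by
    rw [Finset.disjoint_left]
    simp only [Finset.mem_image, Finset.mem_product, Finset.mem_range, Prod.exists, not_exists,
      not_and]
    rintro _ ⟨x, X, ⟨hx, hX⟩, rfl⟩ Y hY hXY
    have := (low subset_rfl (herase x) (hU Y hY) (hT X hX) hXY).1
    exact Finset.notMem_erase x (Finset.range c) (this ▸ Finset.mem_range.2 hx)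
  have hdj : ∀ {R X : Finset ℕ}, R ⊆ Finset.range c → (∀ x ∈ X, c ≤ x) → Disjoint R X := by
    intro R X hR hX
    exact Finset.disjoint_left.2 fun x hxR hxX ↦
      (Finset.mem_range.1 (hR hxR)).not_ge (hX x hxX)
  calc c * T.card + U.card
      = ((Finset.range c ×ˢ T).image f ∪ U.image g).card := by
        rw [Finset.card_union_of_disjoint hdisj, Finset.card_image_of_injOn hfinj,
          Finset.card_image_of_injOn hginj, Finset.card_product, Finset.card_range]
    _ = ((fun X : Finset ℕ ↦ (X : Set ℕ)) ''
          ((Finset.range c ×ˢ T).image f ∪ U.image g : Finset (Finset ℕ))).ncard := by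
        rw [Set.ncard_image_of_injective _ Finset.coe_injective, Set.ncard_coe_finset]
    _ ≤ G.splitCount s t i := by
        refine Set.ncard_le_ncard ?_ ((finite_splitStates hE).subset fun F hF ↦ hF.1)
        rintro _ ⟨F, hF, rfl⟩
        simp only [Finset.coe_union, Finset.coe_image, Set.mem_union, Set.mem_image,
          Finset.mem_coe, Finset.mem_product, Finset.mem_range, Prod.exists] at hF
        obtain ⟨x, X, ⟨hx, hX⟩, rfl⟩ | ⟨X, hX, rfl⟩ := hF
        · refine ⟨hTs x hx X hX, ?_⟩
          rw [Set.ncard_coe_finset, hf]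
          simp only
          rw [Finset.card_union_of_disjoint (hdj (herase x) (hT X hX)),
            Finset.card_erase_of_mem (Finset.mem_range.2 hx), Finset.card_range]
          have := hTi X hX
          omega
        · refine ⟨hUs X hX, ?_⟩
          rw [Set.ncard_coe_finset, hg]
          simp only
          rw [Finset.card_union_of_disjoint (hdj subset_rfl (hU X hX)), Finset.card_range]
          have := hUi X hX
          omega

end Constructions

/-! ### The path with a multiple last edge -/

section Chain

/-- The path on the vertices `0, …, d + 1` whose last edge is replaced by `k` parallel edges. -/
def chain (d k : ℕ) : Graph ℕ ℕ :=
  ofEnds (d + 2) (d + k) (min · d) (min · d + 1) fun e _ ↦ by constructor <;> simp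

variable {d k : ℕ}

lemma chain_isLink {e : ℕ} (he : e < d + k) : (chain d k).IsLink e (min e d) (min e d + 1) :=
  ofEnds_isLink (a := (min · d)) (b := (min · d + 1)) he

lemma isTerminalGraph_chain (hk : 1 ≤ k) :
    IsTerminalGraph (d + 2) (d + k) (chain d k) 0 (d + 1) := by
  refine isTerminalGraph_ofEnds (by simp) (by omega) (by omega) (by omega)
    (isConnected_of_rank id (s := 0) (show 0 < d + 2 by omega) fun v (hv : v < d + 2) ↦ ?_)
  rcases Nat.eq_zero_or_pos v with rfl | hv0
  · exact .inl rfl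
  · refine .inr ⟨v - 1, v - 1, ?_, by simp; omega⟩
    have := (chain_isLink (d := d) (k := k) (e := v - 1) (by omega)).symm
    rwa [min_eq_left (by omega), Nat.sub_add_cancel hv0] at this

/-- An edge set of a chain that misses exactly one of the classes of parallel edges is split. -/
lemma mem_splitStates_chain {F : Set ℕ} {i : ℕ} (hF : ∀ e ∈ F, e < d + k) (hi : i ≤ d)
    (hmiss : ∀ e ∈ F, min e d ≠ i) (hhit : ∀ l ≤ d, l ≠ i → ∃ e ∈ F, min e d = l) :
    F ∈ (chain d k).splitStates 0 (d + 1) := by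
  have hlink : ∀ l ≤ d, l ≠ i → ∃ e, ((chain d k).restrict F).IsLink e l (l + 1) := by
    intro l hl hli
    obtain ⟨e, he, rfl⟩ := hhit l hl hli
    exact ⟨e, he, chain_isLink (hF e he)⟩
  -- The rank decreases towards 0 on the `s` side and towards `d + 1` on the other; `2 * d + 4` is
  -- large enough that the subtraction does not truncate.
  refine ⟨hF, isSplit_of_rank {v | v ≤ i} (fun v ↦ if v ≤ i then v else 2 * d + 4 - v)
    (Nat.zero_le i) (fun h : d + 1 ≤ i ↦ by omega) ?_ ?_⟩
  · rintro e u v ⟨he, -, ⟨rfl, rfl⟩ | ⟨rfl, rfl⟩⟩ hu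
    · have := hmiss e he
      simp only [Set.mem_ofPred_eq] at hu ⊢
      omega
    · simp only [Set.mem_ofPred_eq] at hu ⊢
      omega
  · intro v (hv : v < d + 2)
    by_cases hvi : v ≤ i
    · rcases Nat.eq_zero_or_pos v with rfl | hv0
      · exact .inl rfl
      · obtain ⟨e, he⟩ := hlink (v - 1) (by omega) (by omega)
        rw [Nat.sub_add_cancel hv0] at he
        refine .inr (.inr ⟨e, v - 1, he.symm, ?_⟩)
        rw [if_pos hvi, if_pos (by omega)]
        omega
    · by_cases hvd : v = d + 1
      · exact .inr (.inl hvd)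
      · obtain ⟨e, he⟩ := hlink v (by omega) (by omega)
        refine .inr (.inr ⟨e, v + 1, he, ?_⟩)
        rw [if_neg hvi, if_neg (by omega)]
        omega

lemma chainCount_le_splitCount_chain (hk : 1 ≤ k) (j : ℕ) :
    chainCount d k j ≤ (chain d k).splitCount 0 (d + 1) (d + j) := by
  -- Either one path edge is missing and `j + 1` parallel edges are present, or the whole path and
  -- no parallel edge. The second family is `{∅}` for `j = 0` and empty otherwise, matching
  -- `Nat.choose 0 j`.
  have := le_splitCount_of_families (isTerminalGraph_chain (d := d) hk).finite_edgeSet d (d + j)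
    ((Finset.Ico d (d + k)).powersetCard (j + 1)) ((∅ : Finset ℕ).powersetCard j) (s := 0)
    (t := d + 1)
    (fun X hX x hx ↦ (Finset.mem_Ico.1 ((Finset.mem_powersetCard.1 hX).1 hx)).1)
    (fun X hX x hx ↦ absurd ((Finset.mem_powersetCard.1 hX).1 hx) (Finset.notMem_empty x))
    (fun X hX ↦ by rw [(Finset.mem_powersetCard.1 hX).2]; omega)
    (fun X hX ↦ by rw [(Finset.mem_powersetCard.1 hX).2]; omega) ?_ ?_
  · simpa [chainCount] using this
  · intro g hg X hX
    obtain ⟨hX, hXc⟩ := Finset.mem_powersetCard.1 hX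
    have hX' : ∀ x ∈ X, d ≤ x ∧ x < d + k := fun x hx ↦ Finset.mem_Ico.1 (hX hx)
    refine mem_splitStates_chain (i := g) ?_ hg.le ?_ ?_
    · intro e he
      simp only [Finset.coe_union, Finset.coe_erase, Finset.coe_range, Set.mem_union,
        Set.mem_sdiff, Set.mem_Iio, Set.mem_singleton_iff, Finset.mem_coe] at he
      rcases he with he | he
      · omega
      · exact (hX' e he).2
    · intro e he
      simp only [Finset.coe_union, Finset.coe_erase, Finset.coe_range, Set.mem_union,
        Set.mem_sdiff, Set.mem_Iio, Set.mem_singleton_iff, Finset.mem_coe] at he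
      rcases he with he | he
      · omega
      · have := hX' e he
        omega
    · intro l hl hlg
      obtain rfl | hl := hl.eq_or_lt
      · obtain ⟨x, hx⟩ := Finset.card_pos.1 (show 0 < X.card by omega)
        exact ⟨x, by simp [hx], min_eq_right (hX' x hx).1⟩
      · exact ⟨l, by simp [hl, hlg], min_eq_left hl.le⟩
  · intro X hX
    obtain rfl : X = ∅ := Finset.subset_empty.1 (Finset.mem_powersetCard.1 hX).1
    refine mem_splitStates_chain (i := d) ?_ le_rfl ?_ ?_
    · intro e he
      simp at he
      omega
    · intro e he
      simp at he
      omega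
    · intro l hl hld
      exact ⟨l, by simp; omega, min_eq_left hl⟩

end Chain

/-! ### The path ending in a triangle with a multiple edge -/

section Triangle

/-- The path on the vertices `0, …, c`, followed by the triangle on `c`, `c + 1`, `c + 2` in which
the edge joining `c + 1` and `c + 2` is replaced by `l` parallel edges. -/
def triangleChain (c l : ℕ) : Graph ℕ ℕ :=
  ofEnds (c + 3) (c + 2 + l) (fun e ↦ if e ≤ c + 1 then min e c else c + 1)
    (fun e ↦ if e < c then e + 1 else if e = c + 1 then c + 1 else c + 2)
    fun e _ ↦ by constructor <;> split_ifs <;> omega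

variable {c l e : ℕ}

lemma triangleChain_isLink_iff {x y : ℕ} : (triangleChain c l).IsLink e x y ↔
    e < c + 2 + l ∧ ((x = if e ≤ c + 1 then min e c else c + 1) ∧
        (y = if e < c then e + 1 else if e = c + 1 then c + 1 else c + 2) ∨
      (x = if e < c then e + 1 else if e = c + 1 then c + 1 else c + 2) ∧
        (y = if e ≤ c + 1 then min e c else c + 1)) := Iff.rfl

lemma triangleChain_isLink_of_lt (he : e < c) : (triangleChain c l).IsLink e e (e + 1) := by
  rw [triangleChain_isLink_iff, if_pos (by omega), if_pos he]
  omega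

lemma triangleChain_isLink_self : (triangleChain c l).IsLink c c (c + 2) := by
  rw [triangleChain_isLink_iff, if_pos (by omega), if_neg (by omega), if_neg (by omega)]
  omega

lemma triangleChain_isLink_succ : (triangleChain c l).IsLink (c + 1) c (c + 1) := by
  rw [triangleChain_isLink_iff, if_pos (by omega), if_neg (by omega), if_pos rfl]
  omega

lemma triangleChain_isLink_of_le (he : c + 2 ≤ e) (hel : e < c + 2 + l) :
    (triangleChain c l).IsLink e (c + 1) (c + 2) := by
  rw [triangleChain_isLink_iff, if_neg (by omega), if_neg (by omega), if_neg (by omega)]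
  omega

lemma isTerminalGraph_triangleChain :
    IsTerminalGraph (c + 3) (c + 2 + l) (triangleChain c l) 0 (c + 2) := by
  refine isTerminalGraph_ofEnds (fun e _ ↦ by split_ifs <;> omega) (by omega)
    (by omega) (by omega)
    (isConnected_of_rank id (s := 0) (show 0 < c + 3 by omega) fun v (hv : v < c + 3) ↦ ?_)
  rcases Nat.eq_zero_or_pos v with rfl | hv0
  · exact .inl rfl
  · right
    obtain hv | rfl | rfl : v ≤ c ∨ v = c + 1 ∨ v = c + 2 := by omega
    · have := (triangleChain_isLink_of_lt (c := c) (l := l) (e := v - 1) (by omega)).symm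
      rw [Nat.sub_add_cancel hv0] at this
      exact ⟨_, _, this, by simp; omega⟩
    · exact ⟨_, _, triangleChain_isLink_succ.symm, by simp⟩
    · exact ⟨_, _, triangleChain_isLink_self.symm, by simp⟩

/-- An edge set that misses exactly one edge of the initial path and contains a spanning tree of
the final triangle is split. -/
lemma mem_splitStates_triangleChain_of_lt {F : Set ℕ} {g : ℕ} (hF : ∀ e ∈ F, e < c + 2 + l)
    (hg : g < c) (hgF : g ∉ F) (hpath : ∀ e < c, e ≠ g → e ∈ F)
    (htree : c ∈ F ∧ c + 1 ∈ F ∨ c ∈ F ∧ (∃ x ∈ F, c + 2 ≤ x) ∨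
      c + 1 ∈ F ∧ ∃ x ∈ F, c + 2 ≤ x) :
    F ∈ (triangleChain c l).splitStates 0 (c + 2) := by
  -- `r` will be the rank of `c + 1`, with `c` at rank 6 and `c + 2` at rank 2. It is 7 when `c + 1`
  -- hangs from `c`, and 4 when `c + 1` is joined directly to `c + 2`.
  have hrank : ∃ r : ℕ,
      (∃ e w, ((triangleChain c l).restrict F).IsLink e c w ∧ (w = c + 2 ∨ w = c + 1 ∧ r < 6)) ∧
      ∃ e w, ((triangleChain c l).restrict F).IsLink e (c + 1) w ∧
        (w = c + 2 ∧ 2 < r ∨ w = c ∧ 6 < r) := by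
    rcases htree with ⟨h1, h2⟩ | ⟨h1, x, hx, hcx⟩ | ⟨h1, x, hx, hcx⟩
    · exact ⟨7, ⟨_, _, ⟨h1, triangleChain_isLink_self⟩, .inl rfl⟩,
        _, _, ⟨h2, triangleChain_isLink_succ.symm⟩, .inr ⟨rfl, by norm_num⟩⟩
    · exact ⟨4, ⟨_, _, ⟨h1, triangleChain_isLink_self⟩, .inl rfl⟩,
        _, _, ⟨hx, triangleChain_isLink_of_le hcx (hF x hx)⟩, .inl ⟨rfl, by norm_num⟩⟩
    · exact ⟨4, ⟨_, _, ⟨h1, triangleChain_isLink_succ⟩, .inr ⟨rfl, by norm_num⟩⟩,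
        _, _, ⟨hx, triangleChain_isLink_of_le hcx (hF x hx)⟩, .inl ⟨rfl, by norm_num⟩⟩
  obtain ⟨r, ⟨e₁, w₁, hl₁, hw₁⟩, e₂, w₂, hl₂, hw₂⟩ := hrank
  refine ⟨hF, isSplit_of_rank {v | v ≤ g}
    (fun v ↦ if v ≤ g then v else if v = c + 1 then r else 2 * (c + 3 - v))
    (Nat.zero_le g) (fun h : c + 2 ≤ g ↦ by omega) ?_ ?_⟩
  · rintro e u v ⟨he, hl⟩ (hu : u ≤ g)
    change v ≤ g
    have hge : e ≠ g := fun h ↦ hgF (h ▸ he)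
    rw [triangleChain_isLink_iff] at hl
    split_ifs at hl <;> omega
  · intro v (hv : v < c + 3)
    by_cases hvg : v ≤ g
    · rcases Nat.eq_zero_or_pos v with rfl | hv0
      · exact .inl rfl
      · have hl := triangleChain_isLink_of_lt (c := c) (l := l) (e := v - 1) (by omega)
        rw [Nat.sub_add_cancel hv0] at hl
        refine .inr (.inr ⟨v - 1, v - 1, ⟨hpath _ (by omega) (by omega), hl.symm⟩, ?_⟩)
        rw [if_pos hvg, if_pos (by omega)]
        omega
    · right
      obtain hv | rfl | rfl | rfl : v < c ∨ v = c ∨ v = c + 1 ∨ v = c + 2 := by omega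
      · refine .inr ⟨v, v + 1, ⟨hpath v hv (by omega), triangleChain_isLink_of_lt hv⟩, ?_⟩
        split_ifs <;> omega
      · refine .inr ⟨e₁, w₁, hl₁, ?_⟩
        split_ifs <;> omega
      · refine .inr ⟨e₂, w₂, hl₂, ?_⟩
        split_ifs <;> omega
      · exact .inl rfl

/-- The initial path together with one edge at the vertex `c + 1` is split. -/
lemma mem_splitStates_triangleChain_insert {y : ℕ} (hy : c + 1 ≤ y) (hyl : y < c + 2 + l) :
    insert y (Set.Iio c) ∈ (triangleChain c l).splitStates 0 (c + 2) := by
  -- The vertex `c + 1` lies on the side of `s` exactly when `y` is the edge joining it to `c`;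
  -- giving `c + 2` rank 0 makes the other choices of `y` descend too.
  refine ⟨?_, isSplit_of_rank {v | v ≤ c ∨ v = c + 1 ∧ y = c + 1}
    (fun v ↦ if v = c + 2 then 0 else v) (.inl (Nat.zero_le c))
    (fun h : c + 2 ≤ c ∨ c + 2 = c + 1 ∧ y = c + 1 ↦ by omega) ?_ ?_⟩
  · rintro e (rfl | he)
    · exact hyl
    · exact lt_of_lt_of_le (Set.mem_Iio.1 he) (show c ≤ c + 2 + l by omega)
  · rintro e u v ⟨he, hl⟩ (hu : u ≤ c ∨ u = c + 1 ∧ y = c + 1)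
    change v ≤ c ∨ v = c + 1 ∧ y = c + 1
    have he : e = y ∨ e < c := he
    rw [triangleChain_isLink_iff] at hl
    split_ifs at hl <;> omega
  · intro v (hv : v < c + 3)
    rcases Nat.eq_zero_or_pos v with rfl | hv0
    · exact .inl rfl
    · right
      obtain hv | rfl | rfl : v ≤ c ∨ v = c + 1 ∨ v = c + 2 := by omega
      · have hl := triangleChain_isLink_of_lt (c := c) (l := l) (e := v - 1) (by omega)
        rw [Nat.sub_add_cancel hv0] at hl
        refine .inr ⟨v - 1, v - 1, ⟨.inr (show v - 1 < c by omega), hl.symm⟩, ?_⟩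
        split_ifs <;> omega
      · obtain rfl | hy := hy.eq_or_lt
        · refine .inr ⟨c + 1, c, ⟨.inl rfl, triangleChain_isLink_succ.symm⟩, ?_⟩
          split_ifs <;> omega
        · refine .inr ⟨y, c + 2, ⟨.inl rfl, triangleChain_isLink_of_le hy hyl⟩, ?_⟩
          split_ifs <;> omega
      · exact .inl rfl

/-- Dropping one of the `c` path edges allows any of the `2 * l + 1` spanning trees of the fattened
triangle. Keeping the whole path allows any one of the `l + 1` edges at `c + 1`. -/
lemma le_splitCount_triangleChain (c l : ℕ) :
    c * (2 * l + 1) + (l + 1) ≤ (triangleChain c l).splitCount 0 (c + 2) (c + 1) := by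
  -- The spanning trees of the triangle: both simple edges, or one simple and one parallel edge.
  set T : Finset (Finset ℕ) := insert {c, c + 1}
    ((({c, c + 1} : Finset ℕ) ×ˢ Finset.Ico (c + 2) (c + 2 + l)).image
      fun q ↦ {q.1, q.2}) with hT
  have hTcard : T.card = 2 * l + 1 := by
    rw [hT, Finset.card_insert_of_notMem, Finset.card_image_of_injOn, Finset.card_product,
      Finset.card_pair (by omega), Nat.card_Ico, Nat.add_sub_cancel_left]
    · rintro ⟨a, x⟩ hx ⟨b, y⟩ hy hxy
      simp only [Finset.coe_product, Set.mem_prod, Finset.mem_coe, Finset.mem_insert,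
        Finset.mem_singleton, Finset.mem_Ico] at hx hy
      simp only [Finset.ext_iff, Finset.mem_insert, Finset.mem_singleton] at hxy
      have h1 := hxy a
      have h2 := hxy x
      rw [Prod.mk.injEq]
      omega
    · simp only [Finset.mem_image, Finset.mem_product, Finset.mem_insert, Finset.mem_singleton,
        Finset.mem_Ico, Prod.exists, not_exists, not_and]
      rintro a x hx h
      have : x ∈ ({c, c + 1} : Finset ℕ) := by rw [← h]; simp
      simp only [Finset.mem_insert, Finset.mem_singleton] at this
      omega
  have hTmem : ∀ X ∈ T, X = {c, c + 1} ∨ ∃ a x, (a = c ∨ a = c + 1) ∧ (c + 2 ≤ x ∧ x < c + 2 + l) ∧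
      X = {a, x} := by
    intro X hX
    simp only [hT, Finset.mem_insert, Finset.mem_image, Finset.mem_product, Finset.mem_singleton,
      Finset.mem_Ico, Prod.exists] at hX
    obtain rfl | ⟨a, x, ⟨ha, hx⟩, rfl⟩ := hX
    exacts [.inl rfl, .inr ⟨a, x, ha, hx, rfl⟩]
  have hUmem : ∀ X ∈ (Finset.Ico (c + 1) (c + 2 + l)).powersetCard 1,
      ∃ y, c + 1 ≤ y ∧ y < c + 2 + l ∧ X = {y} := by
    intro X hX
    obtain ⟨hX, hXc⟩ := Finset.mem_powersetCard.1 hX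
    obtain ⟨y, rfl⟩ := Finset.card_eq_one.1 hXc
    have := Finset.mem_Ico.1 (hX (Finset.mem_singleton_self y))
    exact ⟨y, this.1, this.2, rfl⟩
  have := le_splitCount_of_families
    (isTerminalGraph_triangleChain (c := c) (l := l)).finite_edgeSet c (c + 1) T
    ((Finset.Ico (c + 1) (c + 2 + l)).powersetCard 1) (s := 0) (t := c + 2) ?_ ?_ ?_ ?_ ?_ ?_
  · rwa [hTcard, Finset.card_powersetCard, Nat.card_Ico, Nat.choose_one_right,
      show c + 2 + l - (c + 1) = l + 1 by omega] at this
  · intro X hX z hz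
    obtain rfl | ⟨a, x, ha, hx, rfl⟩ := hTmem X hX <;>
    · simp only [Finset.mem_insert, Finset.mem_singleton] at hz
      omega
  · intro X hX z hz
    obtain ⟨y, hy, -, rfl⟩ := hUmem X hX
    rw [Finset.mem_singleton] at hz
    omega
  · intro X hX
    obtain rfl | ⟨a, x, ha, hx, rfl⟩ := hTmem X hX <;> rw [Finset.card_pair (by omega)] <;> omega
  · intro X hX
    obtain ⟨y, -, -, rfl⟩ := hUmem X hX
    rw [Finset.card_singleton, add_comm]
  · intro g hg X hX
    have hmem : ∀ e, e ∈ (((Finset.range c).erase g ∪ X : Finset ℕ) : Set ℕ) ↔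
        (e ≠ g ∧ e < c) ∨ e ∈ X := by simp [and_comm]
    obtain rfl | ⟨a, x, ha, hx, rfl⟩ := hTmem X hX
    · simp only [Finset.mem_insert, Finset.mem_singleton] at hmem
      refine mem_splitStates_triangleChain_of_lt (g := g) ?_ hg ?_ ?_ ?_ <;> simp only [hmem]
      · omega
      · omega
      · omega
      · simp
    · simp only [Finset.mem_insert, Finset.mem_singleton] at hmem
      refine mem_splitStates_triangleChain_of_lt (g := g) ?_ hg ?_ ?_ ?_ <;> simp only [hmem]
      · omega
      · omega
      · omega
      · have hx' : ∃ z, ((z ≠ g ∧ z < c) ∨ z = a ∨ z = x) ∧ c + 2 ≤ z := ⟨x, by simp, hx.1⟩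
        rcases ha with rfl | rfl
        · exact .inr (.inl ⟨by simp, hx'⟩)
        · exact .inr (.inr ⟨by simp, hx'⟩)
  · intro X hX
    obtain ⟨y, hy, hyl, rfl⟩ := hUmem X hX
    convert mem_splitStates_triangleChain_insert hy hyl using 1
    ext e
    simp

end Triangle

/-! ### Optimality of the chain and the obstruction to optimality -/

/-- If the chain has the largest possible counts, it is optimal. -/
lemma isOptimal_chain {d k : ℕ} (hk : 1 ≤ k)
    (h : ∀ (α β : Type) (H : Graph α β) (s t : α), IsTerminalGraph (d + 2) (d + k) H s t →
      ∀ j, H.splitCount s t (d + j) ≤ chainCount d k j) :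
    IsOptimal (d + 2) (d + k) (chain d k) 0 (d + 1) := by
  refine ⟨isTerminalGraph_chain hk, fun α β H s t hH p hp ↦
    (isTerminalGraph_chain hk).splitReliability_le hH (fun i ↦ ?_) hp⟩
  obtain hi | ⟨j, rfl⟩ : i < d ∨ ∃ j, i = d + j :=
    (lt_or_ge i d).imp_right Nat.exists_eq_add_of_le
  · exact (hH.splitCount_of_lt (by omega)).le.trans (Nat.zero_le _)
  · exact (h α β H s t hH j).trans (chainCount_le_splitCount_chain hk j)

/-- An optimal graph beats both the chain and the triangle chain, which is impossible unless
`c = l = 1`. -/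
lemma not_isOptimal {α β : Type} {G : Graph α β} {s t : α} {c l : ℕ} (hcl : 1 < c * l) :
    ¬ IsOptimal (c + 1 + 2) (c + 1 + (l + 1)) G s t := by
  rintro ⟨hG, hopt⟩
  have hchain := isTerminalGraph_chain (d := c + 1) (k := l + 1) (by omega)
  have hhigh := splitCount_le_of_highest (m := c + 1 + l) hG hchain
    (hopt _ _ _ _ _ hchain)
  have hcount := chainCount_le_splitCount_chain (d := c + 1) (k := l + 1) (by omega) l
  have hbridge := hG.splitCount_le_ncard_splitBridges (m := c + 1 + l)
  -- At the top index `chainCount` is at least `c + 1`, so the optimal graph has at least `c + 1`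
  -- split bridges.
  have hupper := hG.splitCount_le_of_le_splitBridges (m := c + 1) (k := l + 1) (by
    rw [chainCount, Nat.choose_self] at hcount
    omega)
  have htri : IsTerminalGraph (c + 1 + 2) (c + 1 + (l + 1)) (triangleChain c l) 0 (c + 2) := by
    convert isTerminalGraph_triangleChain (c := c) (l := l) using 1
    omega
  have hlow := splitCount_le_of_lowest hG htri (by omega) (hopt _ _ _ _ _ htri)
  have := le_splitCount_triangleChain c l
  -- The bounds combine to c(2l+1) + (l+1) ≤ (c+1)(l+1) + 1, that is, cl ≤ 1.
  nlinarith

end Graph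

theorem mainTheorem1 (n m : ℕ) (hn : 2 ≤ n) (hm : n - 1 ≤ m) :
    (∃ (α β : Type) (G : Graph α β) (s t : α), Graph.IsOptimal n m G s t) ↔
      n ≤ 3 ∨ m = n - 1 ∨ (n = 4 ∧ m = 4) := by
  obtain ⟨d, rfl⟩ : ∃ d, n = d + 2 := ⟨n - 2, by omega⟩
  -- In these parameters m ≥ n-1 reads k ≥ 1, and the exceptional cases are d ≤ 1, k = 1 and d = k =
  -- 2.
  obtain ⟨k, rfl⟩ : ∃ k, m = d + k := ⟨m - d, by omega⟩
  constructor
  · rintro ⟨α, β, G, s, t, hG⟩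
    by_contra! hne
    obtain ⟨c, rfl⟩ : ∃ c, d = c + 1 := ⟨d - 1, by omega⟩
    obtain ⟨l, rfl⟩ : ∃ l, k = l + 1 := ⟨k - 1, by omega⟩
    refine Graph.not_isOptimal ?_ hG
    have hc : 1 ≤ c := by omega
    have hl : 1 ≤ l := by omega
    obtain hc | hl : 2 ≤ c ∨ 2 ≤ l := by omega
    · nlinarith
    · nlinarith
  · intro h
    refine ⟨ℕ, ℕ, _, _, _, Graph.isOptimal_chain (d := d) (k := k) (by omega)
      fun α β H s t hH j ↦ ?_⟩
    obtain rfl | rfl | rfl | ⟨rfl, rfl⟩ : d = 0 ∨ d = 1 ∨ k = 1 ∨ (d = 2 ∧ k = 2) := by omega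
    · simp only [zero_add] at hH ⊢
      exact hH.splitCount_le_of_order_two j
    · exact hH.splitCount_le_of_order_three j
    · exact hH.splitCount_le_of_tree j
    · exact hH.splitCount_le_of_order_four j
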